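/- Let $\mathcal L$ be an oriented link in $S^3$ with a marked point, let $L\subset S^2$ be any diagram of $\mathcal L$, the marked point projecting to a non-crossing point $p$ of $L$, and let $\overline L$ be the mirror diagram (the same oriented marked projection with every crossing switched), which is a diagram of the mirror image $\overline{\mathcal L}$. Let $X$ be the set of crossings of $L$, let $n_+(L)$ be the number of right-handed crossings, and let $R$ be the set of faces, i.e. of components of the complement in $S^2$ of the projection (it is the same for $L$ and $\overline L$). Let $\mathbb F_L$ be the field of fractions of $\mathbb Z/2[x_f \mid f\in R]$. For $S\subset X$ let $L_S$ be the resolution of $L$ in which the crossings outside $S$ are $0$-resolved and those in $S$ are $1$-resolved; here the $0$-resolution is the one compatible with the orientation at a right-handed crossing, and the $1$-resolution is the one compatible with the orientation at a left-handed crossing. Let $O_i(L)$ be the set of those $T\subset X$ with $|T|=i$ for which $L_T$ is a single circle, let $CT_i(L)$ be the $\mathbb F_L$-vector space with basis $O_i(L)$, and let $$\partial\colon CT_i(L)\to CT_{i+2}(L),\qquad \partial T=\sum_{T'\in O_{i+2}(L),\ T\subset T'}\Big(\frac1{[B_{T,T'}]}+\frac1{[W_{T,T'}]}\Big)T' .$$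 Here $T'=T\cup\{c_1,c_2\}$; each of $L_{T\cup\{c_1\}}$ and $L_{T\cup\{c_2\}}$ consists of two circles, one of them through $p$; $B_{T,T'}$ and $W_{T,T'}$ are the discs that the other circle of $L_{T\cup\{c_1\}}$, respectively of $L_{T\cup\{c_2\}}$, bounds on the side not containing $p$; and $[A]$ is the sum of the variables of the faces in $A$. Let $HT_i(L)$ be the homology of this complex in degree $i+n_+(L)$, that is, the kernel of $\partial$ on $CT_{i+n_+(L)}(L)$ modulo the image of $CT_{i+n_+(L)-2}(L)$; it is the group $HT_i(\mathcal L)$ computed from the diagram $L$. **Theorem.** For every such diagram $L$ and every $i\in\mathbb Z$ there is an isomorphism of $\mathbb F_L$-vector spaces $$HT_i(L)\;\cong\;HT_{-i}(\overline L).$$ -/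

import Mathlib

noncomputable section

/-- The four ends of strands at each crossing.  At every crossing the ends are numbered
counterclockwise so that `0`, `1` are the two incoming ends and `2`, `3` the two outgoing ones;
the two strands through the crossing run from `0` to `2` and from `1` to `3`. -/
abbrev Dart (X : Type*) := X × ZMod 4

/-- A place of the diagram: an end of a strand at a crossing (standing for the edge of the
four-valent graph that it belongs to), or a component without crossings. -/
abbrev Place (X O : Type*) := Dart X ⊕ O

/-- Local pieces of faces: `inl (c, k)` is the corner at the crossing `c` between the ends `k` and
`k + 1`; `inr (o, true)` and `inr (o, false)` are the left and the right side of the crossingless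
component `o`. -/
abbrev Side (X O : Type*) := Dart X ⊕ (O × Bool)

/-- The piece (crossing or crossingless component) of the diagram to which a side belongs. -/
def Side.piece {X O : Type*} : Side X O → X ⊕ O := Sum.map Prod.fst Prod.fst

/-- An oriented link diagram on the sphere `S²`, up to isotopy of the sphere, with set of crossings
`X`, set of crossingless components `O` and set of faces `R`. -/
structure LinkDiagram (X O R : Type*) where
  /-- the other end of the edge which starts at the given end -/
  edge : Dart X → Dart X
  edge_edge : ∀ d, edge (edge d) = d
  /-- an edge leads from an outgoing end to an incoming end -/
  edge_orient : ∀ d : Dart X,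
    ((edge d).2 = 0 ∨ (edge d).2 = 1) ↔ ¬ (d.2 = 0 ∨ d.2 = 1)
  /-- the face which contains a given side -/
  face : Side X O → R
  face_surjective : Function.Surjective face
  /-- the corners on the same side of an edge lie in the same face -/
  face_edge : ∀ d : Dart X, face (Sum.inl ((edge d).1, (edge d).2 - 1)) = face (Sum.inl d)
  /-- the union of the underlying graph and its faces is connected -/
  connected : ∀ u v : X ⊕ O, Relation.EqvGen (fun u v =>
    (∃ d : Dart X, u = Sum.inl d.1 ∧ v = Sum.inl (edge d).1) ∨
    (∃ s t : Side X O, s.piece = u ∧ t.piece = v ∧ face s = face t)) u v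
  /-- Euler's formula for graphs on the sphere: the number of faces is
  `E - V + (number of connected components of the graph) + 1`, and `E - V` is the number of
  crossings.  Together with `connected` it says that the surface is a sphere. -/
  euler : Nat.card R = Nat.card X +
    Nat.card (Quot (fun u v : X ⊕ O =>
      ∃ d : Dart X, u = Sum.inl d.1 ∧ v = Sum.inl (edge d).1)) + 1
  /-- `true` at right-handed (positive) crossings: the strand from `0` to `2` is the upper one;
  `false` at left-handed (negative) crossings: the strand from `1` to `3` is the upper one -/
  positive : X → Bool

/-- The field of fractions of the polynomial ring over `ℤ/2` with one variable for each face. -/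
def FaceField (R : Type*) := FractionRing (MvPolynomial R (ZMod 2))

instance (R : Type*) : Field (FaceField R) :=
  inferInstanceAs (Field (FractionRing (MvPolynomial R (ZMod 2))))

/-- The formal variable of a face. -/
def faceVar {R : Type*} (f : R) : FaceField R :=
  algebraMap (MvPolynomial R (ZMod 2)) (FractionRing (MvPolynomial R (ZMod 2))) (MvPolynomial.X f)

/-- The formal area of a set of faces: the sum of the variables of its members. -/
def formalArea {R : Type*} [Fintype R] (A : Set R) : FaceField R :=
  open Classical in ∑ f : R with f ∈ A, faceVar f

namespace LinkDiagram

variable {X O R : Type*} (D : LinkDiagram X O R)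

/-- The mirror diagram: same oriented projection, every crossing switched. -/
def mirror : LinkDiagram X O R := { D with positive := fun c => !D.positive c }

/-- The number `n₊` of right-handed crossings. -/
def nPlus [Fintype X] : ℕ := (Finset.univ.filter (fun c => D.positive c = true)).card

/-- In the resolution `L_S` the crossings outside `S` receive the `0`-resolution (the one that
joins the two regions swept out by turning the upper strand counterclockwise), those in `S` the
`1`-resolution.  This says that at `c` the resolution is the one compatible with the orientation:
the `0`-resolution at a positive crossing, the `1`-resolution at a negative one. -/
def OrientedAt (S : Finset X) (c : X) : Prop := D.positive c = true ↔ c ∉ S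

/-- The end to which an end is joined by the resolution `L_S` inside a small disc around its
crossing: `0 ↔ 3`, `1 ↔ 2` for the orientation-compatible resolution, `0 ↔ 1`, `2 ↔ 3` for the
other. -/
def smooth (S : Finset X) (d : Dart X) : Dart X :=
  open Classical in
  if D.OrientedAt S d.1 then (d.1, 3 - d.2) else (d.1, 1 - d.2)

/-- Two places lie on the same circle of the resolution `L_S`. -/
def SameCircle (S : Finset X) : Place X O → Place X O → Prop :=
  Relation.EqvGen (fun x y => ∃ d : Dart X, x = Sum.inl d ∧
    (y = Sum.inl (D.edge d) ∨ y = Sum.inl (D.smooth S d)))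

/-- The resolution `L_S` consists of a single circle. -/
def IsSingleCircle (S : Finset X) : Prop := ∀ x y : Place X O, D.SameCircle S x y

/-- The face to the left of a place, looking outwards from the crossing, respectively along the
orientation of a crossingless component. -/
def leftFace : Place X O → R
  | Sum.inl d => D.face (Sum.inl d)
  | Sum.inr o => D.face (Sum.inr (o, true))

/-- The face to the right of a place. -/
def rightFace : Place X O → R
  | Sum.inl d => D.face (Sum.inl (d.1, d.2 - 1))
  | Sum.inr o => D.face (Sum.inr (o, false))

/-- Two faces lie in the same component of the complement in `S²` of the unmarked circles of `L_S`,
where `p` is the marked point.  One may pass between opposite corners merged by the resolution of a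
crossing (the corners `0`, `2` for the orientation-compatible resolution, `1`, `3` for the other),
and from one side of the marked circle to the other. -/
def SameRegion (p : Place X O) (S : Finset X) : R → R → Prop :=
  Relation.EqvGen (fun f g =>
    (∃ c, D.OrientedAt S c ∧ f = D.face (Sum.inl (c, 0)) ∧ g = D.face (Sum.inl (c, 2))) ∨
    (∃ c, ¬ D.OrientedAt S c ∧ f = D.face (Sum.inl (c, 1)) ∧ g = D.face (Sum.inl (c, 3))) ∨
    (∃ x, D.SameCircle S p x ∧ f = D.leftFace x ∧ g = D.rightFace x))

/-- The faces which are separated from the marked point `p` by the unmarked circles of `L_S`.  If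
`L_S` has exactly one unmarked circle `C`, this is the interior `A_p(C)`: the component of `S² \ C`
that does not contain `p`. -/
def cleaved (p : Place X O) (S : Finset X) : Set R :=
  {f | ¬ D.SameRegion p S f (D.leftFace p)}

/-- `O_i(L)`: the subsets `T` of the set of crossings with `|T| = i` such that `L_T` is a single
circle.  They correspond to spanning trees of a Tait graph of the diagram. -/
abbrev TreeState (i : ℤ) := {T : Finset X // D.IsSingleCircle T ∧ (T.card : ℤ) = i}

/-- `CT_i(L)`: the vector space with basis the finite set `O_i(L)`; an element is given by its
coordinates. -/
abbrev CT (i : ℤ) := D.TreeState i → FaceField R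

/-- The coefficient `⟨T, T'⟩`.  For `T' = T ∪ {c₁, c₂}` the sum has the two summands `1 / [B]` and
`1 / [W]`, where `B` and `W` are the regions cleaved off in the two-circle resolutions given by
`T ∪ {c₁}` and `T ∪ {c₂}`. -/
def pairing [DecidableEq X] [Fintype R] (p : Place X O) (T T' : Finset X) : FaceField R :=
  ∑ c ∈ T' \ T, (formalArea (D.cleaved p (insert c T)))⁻¹

/-- The component `CT_i(L) → CT_j(L)` of the differential, which is zero unless `j = i + 2`:
`∂ T = ∑ ⟨T, T'⟩ T'`, the sum running over the `T' ∈ O_{i+2}(L)` that contain `T`.  The matrix has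
rows indexed by `T'` and columns indexed by `T`. -/
def boundary [Fintype X] [DecidableEq X] [Fintype R] (p : Place X O) (i j : ℤ) :
    D.CT i →ₗ[FaceField R] D.CT j :=
  open Classical in
  Matrix.mulVecLin (Matrix.of fun (T' : D.TreeState j) (T : D.TreeState i) =>
    if j = i + 2 ∧ T.1 ⊆ T'.1 then D.pairing p T.1 T'.1 else 0)

/-- The homology of the unshifted spanning tree complex in degree `i`: the kernel of
`CT_i → CT_{i+2}` modulo the elements of it which lie in the image of `CT_{i-2} → CT_i`. -/
abbrev unHT [Fintype X] [DecidableEq X] [Fintype R] (p : Place X O) (i : ℤ) :=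
  LinearMap.ker (D.boundary p i (i + 2)) ⧸
    (LinearMap.range (D.boundary p (i - 2) i)).submoduleOf (LinearMap.ker (D.boundary p i (i + 2)))

/-- The spanning tree homology `HT_i(L)`: the homology shifted by `[-n₊]`. -/
abbrev HT [Fintype X] [DecidableEq X] [Fintype R] (p : Place X O) (i : ℤ) :=
  D.unHT p (i + D.nPlus)

end LinkDiagram

end

/-! Switching every crossing exchanges the two resolutions, so the mirror diagram resolved along `S`
is the original resolved along `Sᶜ`, with the same circles and cleaved regions. Complementation thus
matches the tree states of the two diagrams, reverses inclusions, and preserves the coefficients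
(`mirror_pairing`), so the mirror differential is the transpose of the original one
(`mirror_boundaryMatrix`). Over a field a finite-dimensional complex and its transpose have homology
of equal dimension. The count below corrects by the rank of `f ∘ₗ g`, so `∂² = 0` is never needed.
-/

theorem finrank_ker_quotient_range {K U V W : Type*} [Field K] [AddCommGroup U] [Module K U]
    [AddCommGroup V] [Module K V] [AddCommGroup W] [Module K W] [FiniteDimensional K V]
    (f : V →ₗ[K] W) (g : U →ₗ[K] V) [FiniteDimensional K U] :
    Module.finrank K (f.ker ⧸ g.range.submoduleOf f.ker) + Module.finrank K f.range
      + Module.finrank K g.range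
      = Module.finrank K V + Module.finrank K (f ∘ₗ g).range := by
  have h₁ := (g.range.submoduleOf f.ker).finrank_quotient_add_finrank
  have h₂ := f.finrank_range_add_finrank_ker
  have h₃ := (f.domRestrict g.range).finrank_range_add_finrank_ker
  -- Both are `f.ker ⊓ g.range`, seen inside `g.range` on one side and inside `f.ker` on the other.
  have h₄ : Module.finrank K (f.domRestrict g.range).ker
      = Module.finrank K (g.range.submoduleOf f.ker) := by
    rw [LinearMap.ker_domRestrict]
    have e₁ := (Submodule.equivSubtypeMap _ (f.ker.submoduleOf g.range)).finrank_eq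
    have e₂ := (Submodule.equivSubtypeMap _ (g.range.submoduleOf f.ker)).finrank_eq
    rw [Submodule.submoduleOf, Submodule.map_comap_subtype] at e₁ e₂
    rw [inf_comm] at e₂
    exact e₁.trans e₂.symm
  have h₅ : (f.domRestrict g.range).range = (f ∘ₗ g).range := by
    rw [LinearMap.range_domRestrict, LinearMap.range_comp]
  rw [h₅] at h₃
  omega

/-- The homology of a pair of matrices has the dimension of the homology of the transposed pair,
whether or not the product of the two matrices vanishes. -/
theorem nonempty_homology_equiv_transpose {K l m n l' m' n' : Type*} [Field K]
    [Fintype l] [Fintype m] [Fintype n] [Fintype l'] [Fintype m'] [Fintype n']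
    (A : Matrix n m K) (B : Matrix m l K) (A' : Matrix l' m' K) (B' : Matrix m' n' K)
    (el : l' ≃ l) (em : m' ≃ m) (en : n' ≃ n)
    (hA : A' = B.transpose.submatrix el em) (hB : B' = A.transpose.submatrix em en) :
    Nonempty ((A.mulVecLin.ker ⧸ B.mulVecLin.range.submoduleOf A.mulVecLin.ker) ≃ₗ[K]
      (A'.mulVecLin.ker ⧸ B'.mulVecLin.range.submoduleOf A'.mulVecLin.ker)) := by
  refine FiniteDimensional.nonempty_linearEquiv_of_finrank_eq ?_
  have h := finrank_ker_quotient_range A.mulVecLin B.mulVecLin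
  have h' := finrank_ker_quotient_range A'.mulVecLin B'.mulVecLin
  rw [← Matrix.mulVecLin_mul] at h h'
  have hAB : A' * B' = (A * B).transpose.submatrix el en := by
    rw [hA, hB, Matrix.submatrix_mul_equiv, Matrix.transpose_mul]
  -- Transposition swaps the ranks of the two maps and keeps that of their product; the dimension
  -- formula is symmetric in the two.
  have rA : A'.rank = B.rank := by rw [hA, Matrix.rank_submatrix, Matrix.rank_transpose]
  have rB : B'.rank = A.rank := by rw [hB, Matrix.rank_submatrix, Matrix.rank_transpose]
  have rAB : (A' * B').rank = (A * B).rank := by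
    rw [hAB, Matrix.rank_submatrix, Matrix.rank_transpose]
  have hm : Fintype.card m' = Fintype.card m := Fintype.card_congr em
  simp only [Matrix.rank] at rA rB rAB
  simp only [Module.finrank_fintype_fun_eq_card] at h h'
  omega

namespace LinkDiagram

variable {X O R : Type*} (D : LinkDiagram X O R)

theorem nPlus_add_mirror_nPlus [Fintype X] : D.nPlus + D.mirror.nPlus = Fintype.card X := by
  have h := Finset.card_filter_add_card_filter_not (s := (Finset.univ : Finset X))
    (fun c => D.positive c = true)
  have h' : D.mirror.nPlus = (Finset.univ.filter fun c => ¬ D.positive c = true).card := by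
    simp [nPlus, mirror]
  rw [h']
  exact h

section Complement

variable [Fintype X] [DecidableEq X]

/-- Both sides of the defining equivalence get negated. Circles and regions depend on the crossing
signs and on `S` only through this predicate. -/
theorem mirror_orientedAt (S : Finset X) (c : X) :
    D.mirror.OrientedAt S c ↔ D.OrientedAt Sᶜ c := by
  unfold OrientedAt mirror
  cases h : D.positive c <;> simp [h]

theorem mirror_smooth (S : Finset X) : D.mirror.smooth S = D.smooth Sᶜ := by
  funext d
  unfold smooth
  by_cases h : D.OrientedAt Sᶜ d.1
  · rw [if_pos h, if_pos ((D.mirror_orientedAt S d.1).mpr h)]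
  · rw [if_neg h, if_neg (mt (D.mirror_orientedAt S d.1).mp h)]

theorem mirror_sameCircle (S : Finset X) : D.mirror.SameCircle S = D.SameCircle Sᶜ := by
  unfold SameCircle
  rw [mirror_smooth]
  rfl

theorem mirror_isSingleCircle (S : Finset X) :
    D.mirror.IsSingleCircle S ↔ D.IsSingleCircle Sᶜ := by
  unfold IsSingleCircle
  rw [mirror_sameCircle]

theorem mirror_cleaved (p : Place X O) (S : Finset X) :
    D.mirror.cleaved p S = D.cleaved p Sᶜ := by
  unfold cleaved SameRegion
  simp only [mirror_orientedAt, mirror_sameCircle]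
  rfl

/-- The complement of a tree state of the mirror diagram is a tree state of the diagram. -/
def mirrorTreeState {k l : ℤ} (h : k + l = Fintype.card X) :
    D.mirror.TreeState k ≃ D.TreeState l :=
  (Equiv.subtypeEquiv (Function.Involutive.toPerm (compl : Finset X → Finset X) compl_involutive)
    fun T => by
      have hT := Finset.card_add_card_compl T
      rw [mirror_isSingleCircle, Function.Involutive.coe_toPerm]
      refine and_congr_right fun _ => ?_
      omega)

@[simp] theorem mirrorTreeState_coe {k l : ℤ} (h : k + l = Fintype.card X)
    (T : D.mirror.TreeState k) : (D.mirrorTreeState h T).1 = T.1ᶜ := rfl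

/-- If `T' \ T = {a, b}`, the complement of `T ∪ {a}` is `T'ᶜ ∪ {b}`, so the two summands merely
trade places. -/
theorem mirror_pairing [Fintype R] (p : Place X O) {T T' : Finset X} (hT : T ⊆ T')
    (hc : T'.card = T.card + 2) : D.mirror.pairing p T T' = D.pairing p T'ᶜ Tᶜ := by
  have hd : (T' \ T).card = 2 := by
    have := Finset.card_sdiff_add_card_eq_card hT
    omega
  have hd' : Tᶜ \ T'ᶜ = T' \ T := by
    ext x; simp [and_comm]
  obtain ⟨a, b, hab, he⟩ := Finset.card_eq_two.mp hd
  have hx : ∀ x, (x ∈ T' ∧ x ∉ T) ↔ (x = a ∨ x = b) := fun x => by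
    rw [← Finset.mem_sdiff, he]; simp
  have key : ∀ u v, u ≠ v → (∀ x, (x ∈ T' ∧ x ∉ T) ↔ (x = u ∨ x = v)) →
      (insert u T)ᶜ = insert v T'ᶜ := by
    intro u v huv hx
    ext x
    have h₁ := hx x
    have h₂ := @hT x
    have h₃ : ¬ (x = u ∧ x = v) := fun h => huv (h.1.symm.trans h.2)
    simp only [Finset.mem_compl, Finset.mem_insert]
    clear hx
    tauto
  unfold pairing
  rw [hd', he, Finset.sum_pair hab, Finset.sum_pair hab, mirror_cleaved, mirror_cleaved,
    key a b hab hx, key b a hab.symm fun x => (hx x).trans or_comm, add_comm]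

open Classical in
/-- The matrix of the differential. -/
noncomputable def boundaryMatrix [Fintype R] (p : Place X O) (i j : ℤ) :
    Matrix (D.TreeState j) (D.TreeState i) (FaceField R) :=
  Matrix.of fun T' T => if j = i + 2 ∧ T.1 ⊆ T'.1 then D.pairing p T.1 T'.1 else 0

theorem mirror_boundaryMatrix [Fintype R] (p : Place X O) {i j i' j' : ℤ}
    (hi : i + i' = Fintype.card X) (hj : j + j' = Fintype.card X) :
    D.mirror.boundaryMatrix p i j =
      (D.boundaryMatrix p j' i').transpose.submatrix
        (D.mirrorTreeState hj) (D.mirrorTreeState hi) := by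
  ext T' T
  simp only [boundaryMatrix, Matrix.of_apply, Matrix.submatrix_apply, Matrix.transpose_apply,
    mirrorTreeState_coe, Finset.compl_subset_compl]
  have hd : j = i + 2 ↔ i' = j' + 2 := by omega
  simp only [← hd]
  split_ifs with h
  · refine D.mirror_pairing p h.2 ?_
    have := T.2.2
    have := T'.2.2
    omega
  · rfl

end Complement

end LinkDiagram

theorem mainTheorem10 {X O R : Type*} [Fintype X] [DecidableEq X] [Fintype O] [Fintype R]
    (D : LinkDiagram X O R) (p : Place X O) (i : ℤ) :
    Nonempty (D.HT p i ≃ₗ[FaceField R] D.mirror.HT p (-i)) := by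
  classical
  have hn := D.nPlus_add_mirror_nPlus
  -- The shifts by `n₊` add up to the number of crossings, so opposite shifted degrees are exactly
  -- complementary cardinalities.
  have h₀ : (-i + D.mirror.nPlus) + (i + D.nPlus) = (Fintype.card X : ℤ) := by omega
  have h₁ : (-i + D.mirror.nPlus - 2) + (i + D.nPlus + 2) = (Fintype.card X : ℤ) := by omega
  have h₂ : (-i + D.mirror.nPlus + 2) + (i + D.nPlus - 2) = (Fintype.card X : ℤ) := by omega
  -- `boundary` unfolds to `mulVecLin` of `boundaryMatrix`. The outgoing mirror differential is the
  -- transpose of the incoming original one, and vice versa.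
  exact nonempty_homology_equiv_transpose _ _ _ _ (D.mirrorTreeState h₂) (D.mirrorTreeState h₀)
    (D.mirrorTreeState h₁) (D.mirror_boundaryMatrix p h₀ h₂) (D.mirror_boundaryMatrix p h₁ h₀)
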